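/- Let $(\mathbb X,d)$ be a complete separable metric space (e.g. a separable Banach space) with Borel $\sigma$-algebra $\mathcal B(\mathbb X)$, and let $(\Omega,\mathcal F,P,(\theta_t)_{t\in\mathbb R})$ be a metric dynamical system: $P$ is a probability measure, $(t,\omega)\mapsto\theta_t\omega$ is measurable, $\theta_t\circ\theta_s=\theta_{t+s}$ and $\theta_tP=P$. Let $\Phi:\mathbb R^+\times\Omega\times\mathbb X\to\mathbb X$ be a random dynamical system over $\theta$, that is, $\Phi$ is measurable and, almost surely, $\Phi(0,\omega)=\mathrm{id}$ and $\Phi(t+s,\omega)=\Phi(t,\theta_s\omega)\circ\Phi(s,\omega)$ for all $t,s\ge 0$. Assume that $\Phi$ is a Markovian cocycle: there are $\sigma$-algebras $\mathcal F_s^t\subseteq\mathcal F$ $(s\le t)$ with $\mathcal F_s^t\subseteq\mathcal F_u^v$ for $u\le s\le t\le v$ and $\theta_u^{-1}\mathcal F_s^t=\mathcal F_{s+u}^{t+u}$, such that $\mathcal F_{-\infty}^s:=\bigvee_{r\le s}\mathcal F_r^s$ is independent of $\mathcal F_s^t$ for all $s\le t$, and $(\omega,x)\mapsto\Phi(t,\omega)x$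 is $\mathcal F_0^t\otimes\mathcal B(\mathbb X)$-measurable for every $t\ge 0$. Let $\tau>0$ and let $Y:\mathbb R\times\Omega\to\mathbb X$ be an adapted random periodic path of period $\tau$: each $Y(s,\cdot)$ is $\mathcal F_{-\infty}^s$-measurable and, for almost every $\omega$, $\Phi(t,\theta_s\omega)Y(s,\omega)=Y(t+s,\omega)$ and $Y(s+\tau,\omega)=Y(s,\theta_\tau\omega)$ for all $t\ge 0$, $s\in\mathbb R$. For a measurable space $S$ let $L_b(S)$ be the set of bounded measurable functions $S\to\mathbb R$. Put $(P_t\varphi)(x)=\int_\Omega\varphi(\Phi(t,\omega)x)\,P(d\omega)$ for $\varphi\in L_b(\mathbb X)$, $\rho_s=P\circ Y(s,\cdot)^{-1}$, and $$\tilde T[\varphi]=\sup_{s\in[0,\tau)}\int_{\mathbb X}\varphi\,d\rho_s,\qquad\varphi\in L_b(\mathbb X).$$ Assume Condition A: for every $s\in\mathbb R$ and every Borel set $\Gamma$ with $P_\tau 1_\Gamma=1_\Gamma$ $\rho_s$-a.s., for $P$-almost every $\omega$ the set $L_s^\omega=\{Y(s+k\tau,\omega):k\in\mathbb Z\}$ satisfies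 either $L_s^\omega\cap\Gamma=\emptyset$ or $L_s^\omega\subseteq\Gamma$. Assume also that $(\Omega,\mathcal F,P,(\theta_\tau^n)_{n\ge1})$ is ergodic. On the path space $\Omega^*=\mathbb X^{\mathbb R}$, with the $\sigma$-algebra $\mathcal F^*$ generated by the cylinder sets and the shifts $(\theta^*_t\omega^*)(s)=\omega^*(t+s)$, consider the cylinder functions $\xi(\omega^*)=\varphi(\omega^*(t_1),\dots,\omega^*(t_n))$, $t_1<\dots<t_n$, $\varphi\in L_b(\mathbb X^n)$, and put $\mathbb E^{\tilde T}[\xi]=\tilde T[\varphi_{n-1}]$, where $\varphi_0=\varphi$ and $$\varphi_i(x_1,\dots,x_{n-i})=P_{t_{n-i+1}-t_{n-i}}[\varphi_{i-1}(x_1,\dots,x_{n-i},\cdot)](x_{n-i}),\qquad 1\le i\le n-1.$$ Let $\mathcal Q$ be the set of probability measures $Q$ on $(\Omega^*,\mathcal F^*)$ with $\int\xi\,dQ\le\mathbb E^{\tilde T}[\xi]$ for all such cylinder functions $\xi$; extend $\mathbb E^{\tilde T}$ by $\mathbb E^{\tilde T}[\xi]=\sup_{Q\in\mathcal Q}\int\xi\,dQ$.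 Let $L_0^2(\Omega^*)$, respectively $L_G^2(\Omega^*)$, be the set of $\mathcal F^*$-measurable functions that are limits, in the norm $\sup_{Q\in\mathcal Q}\|\cdot\|_{L^2(Q)}=(\mathbb E^{\tilde T}[|\cdot|^2])^{1/2}$, of bounded measurable, respectively bounded Lipschitz, cylinder functions. Then $(P_t)_{t\ge0}$ is a sublinear Markovian semigroup on $L_b(\mathbb X)$, $\tilde T$ is a sublinear expectation on $L_b(\mathbb X)$ with $\tilde T[P_t\varphi]=\tilde T[\varphi]$ for all $t\ge0$ and $\varphi\in L_b(\mathbb X)$, the extended $\mathbb E^{\tilde T}$ agrees with the original one on cylinder functions, and $\tilde T$ is ergodic with respect to $(P_t)_{t\ge0}$: the canonical system $(\Omega^*,D,(\theta^*_t)_{t\in\mathbb R},\mathbb E^{\tilde T})$ is ergodic for $D=L_G^2(\Omega^*)$, and also for $D=L_0^2(\Omega^*)$. This means that $\xi\circ\theta_t^*\in D$ and $\mathbb E^{\tilde T}[\xi\circ\theta_t^*]=\mathbb E^{\tilde T}[\xi]$ for all $\xi\in D$, $t\in\mathbb R$, and that every $B\subseteq\Omega^*$ with $1_B\in D$ which is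 invariant, i.e. $\mathbb E^{\tilde T}[1_{(\theta_t^*)^{-1}B\,\triangle\,B}]=0$ for every $t\in\mathbb R$, satisfies $\mathbb E^{\tilde T}[1_B]=0$ or $\mathbb E^{\tilde T}[1_{B^c}]=0$. -/

import Mathlib

open MeasureTheory ProbabilityTheory
open scoped NNReal ENNReal

namespace UpperExpectation

noncomputable section

/-! ### Random dynamical systems and random periodic paths -/

/-- Metric dynamical system: a jointly measurable one-parameter family `θ` of transformations with
`θ_t ∘ θ_s = θ_{t+s}`, preserving the probability measure `P`. -/
structure IsMetricDS {Ω : Type*} [MeasurableSpace Ω] (P : Measure Ω) (θ : ℝ → Ω → Ω) : Prop where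
  measurable : Measurable fun p : ℝ × Ω => θ p.1 p.2
  comp : ∀ t s : ℝ, θ t ∘ θ s = θ (t + s)
  preserves : ∀ s : ℝ, P.map (θ s) = P

/-- Random dynamical system over `θ`: a measurable map `Φ : ℝ⁺ × Ω × X → X` which almost surely
satisfies `Φ(0, ω) = id` and the cocycle property. -/
structure IsRDS {Ω X : Type*} [MeasurableSpace Ω] [MeasurableSpace X] (P : Measure Ω)
    (θ : ℝ → Ω → Ω) (Φ : ℝ≥0 → Ω → X → X) : Prop where
  measurable : Measurable fun p : ℝ≥0 × Ω × X => Φ p.1 p.2.1 p.2.2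
  cocycle : ∀ᵐ ω ∂P, Φ 0 ω = id ∧
    ∀ t s : ℝ≥0, Φ (t + s) ω = Φ t (θ (s : ℝ) ω) ∘ Φ s ω

/-- The past `𝓕_{-∞}^s = ⋁_{r ≤ s} 𝓕_r^s`. -/
abbrev past {Ω : Type*} (𝓕 : ℝ → ℝ → MeasurableSpace Ω) (s : ℝ) : MeasurableSpace Ω :=
  ⨆ r : Set.Iic s, 𝓕 (r : ℝ) s

/-- `Φ` is a Markovian cocycle over the filtered dynamical system
`(Ω, 𝓕, P, (θ_t), (𝓕_s^t)_{s ≤ t})`: the `𝓕_s^t ⊆ 𝓕` increase with the interval `[s, t]`, are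
compatible with the shifts, the past is independent of the future, and `Φ(t, ·)` is measurable with
respect to `𝓕_0^t`. -/
structure IsMarkovianCocycle {Ω X : Type*} [mΩ : MeasurableSpace Ω] [mX : MeasurableSpace X]
    (P : Measure Ω) (θ : ℝ → Ω → Ω) (Φ : ℝ≥0 → Ω → X → X)
    (𝓕 : ℝ → ℝ → MeasurableSpace Ω) : Prop where
  le : ∀ s t : ℝ, s ≤ t → 𝓕 s t ≤ mΩ
  mono : ∀ u s t v : ℝ, u ≤ s → s ≤ t → t ≤ v → 𝓕 s t ≤ 𝓕 u v
  shift : ∀ s t u : ℝ, s ≤ t → (𝓕 s t).comap (θ u) = 𝓕 (s + u) (t + u)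
  indep : ∀ s t : ℝ, s ≤ t → Indep (past 𝓕 s) (𝓕 s t) P
  measurable : ∀ t : ℝ≥0,
    Measurable[(𝓕 0 (t : ℝ)).prod mX, mX] fun p : Ω × X => Φ t p.1 p.2

/-- Random periodic path of period `τ > 0` of the random dynamical system `Φ`. -/
structure IsRandomPeriodicPath {Ω X : Type*} [MeasurableSpace Ω] [MeasurableSpace X]
    (P : Measure Ω) (θ : ℝ → Ω → Ω) (Φ : ℝ≥0 → Ω → X → X) (τ : ℝ) (Y : ℝ → Ω → X) : Prop where
  period_pos : 0 < τ
  measurable : ∀ s : ℝ, Measurable (Y s)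
  path : ∀ᵐ ω ∂P, (∀ (t : ℝ≥0) (s : ℝ), Φ t (θ s ω) (Y s ω) = Y (t + s) ω) ∧
    ∀ s : ℝ, Y (s + τ) ω = Y s (θ τ ω)

/-- The random periodic path is adapted: `Y(s, ·)` is `𝓕_{-∞}^s`-measurable for every `s`. -/
def IsAdaptedPath {Ω X : Type*} [mX : MeasurableSpace X] (𝓕 : ℝ → ℝ → MeasurableSpace Ω)
    (Y : ℝ → Ω → X) : Prop :=
  ∀ s : ℝ, Measurable[past 𝓕 s, mX] (Y s)

/-! ### The Markov semigroup, the periodic measure and Condition A -/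

/-- `(P_t φ)(x) = ∫ φ(y) P(t, x, dy)`, where `P(t, x, ·)` is the law of `Φ(t, ·) x`. -/
def markovSemigroup {Ω X : Type*} [MeasurableSpace Ω] [MeasurableSpace X] (P : Measure Ω)
    (Φ : ℝ≥0 → Ω → X → X) (t : ℝ≥0) (φ : X → ℝ) (x : X) : ℝ :=
  ∫ y, φ y ∂(P.map fun ω => Φ t ω x)

/-- `ρ_s`, the law of `Y(s, ·)`. -/
def periodicMeasure {Ω X : Type*} [MeasurableSpace Ω] [MeasurableSpace X] (P : Measure Ω)
    (Y : ℝ → Ω → X) (s : ℝ) : Measure X :=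
  P.map (Y s)

/-- `L_s^ω = {Y(s + kτ, ω) : k ∈ ℤ}`. -/
def pathSection {Ω X : Type*} (τ : ℝ) (Y : ℝ → Ω → X) (s : ℝ) (ω : Ω) : Set X :=
  Set.range fun k : ℤ => Y (s + k * τ) ω

/-- Condition A: for every `s` and every Borel set `Γ` with `P_τ 1_Γ = 1_Γ` `ρ_s`-a.s., for almost
every `ω` either `L_s^ω ∩ Γ = ∅` or `L_s^ω ⊆ Γ`. -/
def ConditionA {Ω X : Type*} [MeasurableSpace Ω] [MeasurableSpace X] (P : Measure Ω)
    (Φ : ℝ≥0 → Ω → X → X) (τ : ℝ) (Y : ℝ → Ω → X) : Prop :=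
  ∀ (s : ℝ) (Γ : Set X), MeasurableSet Γ →
    markovSemigroup P Φ τ.toNNReal (Γ.indicator 1) =ᵐ[periodicMeasure P Y s] Γ.indicator 1 →
    ∀ᵐ ω ∂P, pathSection τ Y s ω ∩ Γ = ∅ ∨ pathSection τ Y s ω ⊆ Γ

/-! ### Sublinear expectations and sublinear Markovian semigroups -/

/-- The space `L_b(X)` of bounded measurable real functions. -/
def Lb (X : Type*) [MeasurableSpace X] : Set (X → ℝ) :=
  {φ | Measurable φ ∧ ∃ C : ℝ, ∀ x, |φ x| ≤ C}

/-- `E` is a sublinear expectation on `L_b(X)`. -/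
structure IsSublinearExpectation {X : Type*} [MeasurableSpace X] (E : (X → ℝ) → ℝ) : Prop where
  mono : ∀ φ ∈ Lb X, ∀ ψ ∈ Lb X, (∀ x, φ x ≤ ψ x) → E φ ≤ E ψ
  const : ∀ c : ℝ, E (fun _ => c) = c
  add_le : ∀ φ ∈ Lb X, ∀ ψ ∈ Lb X, E (fun x => φ x + ψ x) ≤ E φ + E ψ
  pos_smul : ∀ φ ∈ Lb X, ∀ c : ℝ, 0 ≤ c → E (fun x => c * φ x) = c * E φ

/-- `T` is a sublinear Markovian semigroup on `L_b(X)`. -/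
structure IsSublinearMarkovSemigroup {X : Type*} [MeasurableSpace X]
    (T : ℝ≥0 → (X → ℝ) → X → ℝ) : Prop where
  mapsTo : ∀ t, ∀ φ ∈ Lb X, T t φ ∈ Lb X
  sublinear : ∀ t x, IsSublinearExpectation fun φ => T t φ x
  zero : ∀ φ ∈ Lb X, T 0 φ = φ
  comp : ∀ t s, ∀ φ ∈ Lb X, T t (T s φ) = T (t + s) φ

/-- `E` is invariant under the semigroup `T`. -/
def IsInvariantExpectation {X : Type*} [MeasurableSpace X]
    (T : ℝ≥0 → (X → ℝ) → X → ℝ) (E : (X → ℝ) → ℝ) : Prop :=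
  ∀ t, ∀ φ ∈ Lb X, E (T t φ) = E φ

/-- The upper expectation `T̃[φ] = sup_{s ∈ [0, τ)} ∫ φ dρ_s`. -/
def upperExpectation {X : Type*} [MeasurableSpace X] (ρ : ℝ → Measure X) (τ : ℝ)
    (φ : X → ℝ) : ℝ :=
  ⨆ s : Set.Ico (0 : ℝ) τ, ∫ x, φ x ∂(ρ s)

/-! ### The canonical system on the path space `ℝ → X`

The product σ-algebra on `ℝ → X` is the one generated by the cylinder sets. -/

/-- The shift `(θ*_t ω)(s) = ω(t + s)`. -/
def pathShift {X : Type*} (t : ℝ) (ω : ℝ → X) : ℝ → X := fun s => ω (t + s)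

/-- For times `t_0 < ⋯ < t_n` and `φ` on `X^{n+1}`, integrate out the last variable with
`T_{t_n - t_{n-1}}` started at `x_{n-1}`, then the last but one, and so on, down to a function of
the first variable `x_0`. -/
def iterateSemigroup {X : Type*} (T : ℝ≥0 → (X → ℝ) → X → ℝ) :
    (n : ℕ) → (Fin (n + 1) → ℝ) → ((Fin (n + 1) → X) → ℝ) → X → ℝ
  | 0, _, φ => fun x => φ fun _ => x
  | n + 1, t, φ =>
      iterateSemigroup T n (fun i => t i.castSucc) fun x =>
        T (t (Fin.last (n + 1)) - t (Fin.last n).castSucc).toNNReal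
          (fun y => φ (Fin.snoc (α := fun _ => X) x y)) (x (Fin.last n))

/-- The value `E^{T̃}[φ(ω(t_0), …, ω(t_n))]` of the sublinear expectation on cylinder functions. -/
def cylinderExpectation {X : Type*} (T : ℝ≥0 → (X → ℝ) → X → ℝ) (E : (X → ℝ) → ℝ) (n : ℕ)
    (t : Fin (n + 1) → ℝ) (φ : (Fin (n + 1) → X) → ℝ) : ℝ :=
  E (iterateSemigroup T n t φ)

/-- `L_0(𝓕*)`, the bounded measurable cylinder functions. Taking the times strictly increasing is no
restriction: they can be sorted and repetitions removed. -/
def cylinderFunctions (X : Type*) [MeasurableSpace X] : Set ((ℝ → X) → ℝ) :=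
  {ξ | ∃ (n : ℕ) (t : Fin (n + 1) → ℝ) (φ : (Fin (n + 1) → X) → ℝ),
    StrictMono t ∧ φ ∈ Lb (Fin (n + 1) → X) ∧ ξ = fun ω => φ fun i => ω (t i)}

/-- `Lip_{b,cyl}(Ω*)`, the bounded Lipschitz cylinder functions. -/
def lipCylinderFunctions (X : Type*) [PseudoMetricSpace X] : Set ((ℝ → X) → ℝ) :=
  {ξ | ∃ (n : ℕ) (t : Fin (n + 1) → ℝ) (φ : (Fin (n + 1) → X) → ℝ),
    StrictMono t ∧ (∃ K : ℝ≥0, LipschitzWith K φ) ∧ (∃ C : ℝ, ∀ x, |φ x| ≤ C) ∧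
    ξ = fun ω => φ fun i => ω (t i)}

/-- The probability measures on the path space that are dominated by `E^{T̃}` on the cylinder
functions. -/
def pathMeasures {X : Type*} [MeasurableSpace X] (T : ℝ≥0 → (X → ℝ) → X → ℝ)
    (E : (X → ℝ) → ℝ) : Set (Measure (ℝ → X)) :=
  {Q | IsProbabilityMeasure Q ∧
    ∀ (n : ℕ) (t : Fin (n + 1) → ℝ) (φ : (Fin (n + 1) → X) → ℝ),
      StrictMono t → φ ∈ Lb (Fin (n + 1) → X) →
      ∫ ω, φ (fun i => ω (t i)) ∂Q ≤ cylinderExpectation T E n t φ}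

/-- `E^{T̃}` on functions on the path space, as the upper expectation over `pathMeasures T E`. -/
def pathExpectation {X : Type*} [MeasurableSpace X] (T : ℝ≥0 → (X → ℝ) → X → ℝ)
    (E : (X → ℝ) → ℝ) (ξ : (ℝ → X) → ℝ) : ℝ :=
  ⨆ Q : pathMeasures T E, ∫ ω, ξ ω ∂(Q : Measure (ℝ → X))

/-- `E^{T̃}` restricted to cylinder functions is given by `cylinderExpectation`. -/
def ExtendsCylinderExpectation {X : Type*} [MeasurableSpace X]
    (T : ℝ≥0 → (X → ℝ) → X → ℝ) (E : (X → ℝ) → ℝ) : Prop :=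
  ∀ (n : ℕ) (t : Fin (n + 1) → ℝ) (φ : (Fin (n + 1) → X) → ℝ),
    StrictMono t → φ ∈ Lb (Fin (n + 1) → X) →
    pathExpectation T E (fun ω => φ fun i => ω (t i)) = cylinderExpectation T E n t φ

/-- The norm `(E^{T̃}[|ξ|²])^{1/2}`. -/
def pathNorm {X : Type*} [MeasurableSpace X] (T : ℝ≥0 → (X → ℝ) → X → ℝ)
    (E : (X → ℝ) → ℝ) (ξ : (ℝ → X) → ℝ) : ℝ≥0∞ :=
  ⨆ Q : pathMeasures T E, eLpNorm ξ 2 (Q : Measure (ℝ → X))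

/-- The completion of a space `C` of functions on the path space under `(E^{T̃}[|·|²])^{1/2}`,
realised by the measurable functions that are limits of elements of `C`. -/
def pathCompletion {X : Type*} [MeasurableSpace X] (T : ℝ≥0 → (X → ℝ) → X → ℝ)
    (E : (X → ℝ) → ℝ) (C : Set ((ℝ → X) → ℝ)) : Set ((ℝ → X) → ℝ) :=
  {ξ | Measurable ξ ∧ ∀ ε : ℝ≥0∞, 0 < ε → ∃ η ∈ C, pathNorm T E (ξ - η) < ε}

/-- Ergodicity of the sublinear expectation dynamical system `(S, D, E, (θ_t))`: the maps `θ_t`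
preserve `E` on `D`, and every invariant event `B` (one with `1_B ∈ D`) satisfies `E[1_B] = 0` or
`E[1_{Bᶜ}] = 0`. Functions in `D` are identified when they agree quasi-surely, so the event `B` is
invariant when, for every `t`, `θ_t⁻¹ B` and `B` differ by an event of zero expectation. -/
structure IsErgodicSystem {S : Type*} (D : Set (S → ℝ)) (E : (S → ℝ) → ℝ)
    (θ : ℝ → S → S) : Prop where
  preserves : ∀ t : ℝ, ∀ ξ ∈ D, ξ ∘ θ t ∈ D ∧ E (ξ ∘ θ t) = E ξ
  ergodic : ∀ B : Set S, B.indicator 1 ∈ D →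
    (∀ t : ℝ, E ((symmDiff (θ t ⁻¹' B) B).indicator 1) = 0) →
    E (B.indicator 1) = 0 ∨ E (Bᶜ.indicator 1) = 0

end

end UpperExpectation

open UpperExpectation

/-! Since `ρ_s` is `τ`-periodic in `s`, the supremum defining `T̃` may be taken over all real `s`, a
set on which time translations act. The Markov property (a function of the past integrated against
an independent increment of the cocycle) shows that `P_t` carries `ρ_s` to `ρ_{t+s}`, whence
invariance, and that iterating `P_t` from `ρ_s` yields the finite-dimensional laws of `Y`. So on
cylinder functions `E^{T̃}` is the supremum over `s` of integrals against `pathLaw P Y s`, the law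
of `r ↦ Y(s + r)` (`isLUB_cylinderExpectation`). These laws belong to `pathMeasures`, so the
extension agrees on cylinder functions. Upper bounds holding under all of them pass to every
dominated `Q`, and survive limits in the uniform `L²` norm (`integral_le_of_mem_pathCompletion`).

For ergodicity, `pathLaw P Y s` is the image of `pathLaw P Y 0` under the shift by `s`, so an
invariant `B` has the same mass under all of them. Periodicity intertwines `θ_τ` with the path shift
by `τ`, so ergodicity of `θ_τ` forces this mass to be 0 or 1 (`pathLaw_eq_zero_or`). Applying the
transfer of upper bounds to `1_B`, respectively `-1_B`, makes `B`, respectively its complement, null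
under every `Q`. -/

open UpperExpectation

namespace UpperExpectation

/-! ### Freezing one of two independent variables -/

section Freezing

variable {Ω V S : Type*}

/-- Integrating a function of two independent variables one variable at a time. -/
theorem integral_comp_indepFun [MeasurableSpace Ω] [MeasurableSpace V] [MeasurableSpace S]
    {P : Measure Ω} [IsProbabilityMeasure P] {f : Ω → V} {Z : Ω → S}
    (hf : Measurable f) (hZ : Measurable Z) (hind : IndepFun Z f P)
    {h : V × S → ℝ} (hh : h ∈ Lb (V × S)) :
    ∫ ω, h (f ω, Z ω) ∂P = ∫ ω, ∫ ω', h (f ω', Z ω) ∂P ∂P := by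
  obtain ⟨hm, C, hC⟩ := hh
  have : IsProbabilityMeasure (P.map f) := Measure.isProbabilityMeasure_map hf.aemeasurable
  have : IsProbabilityMeasure (P.map Z) := Measure.isProbabilityMeasure_map hZ.aemeasurable
  have hprod := (indepFun_iff_map_prod_eq_prod_map_map hZ.aemeasurable hf.aemeasurable).1 hind
  have hms : Measurable fun p : S × V => h (p.2, p.1) := hm.comp measurable_swap
  have hint : Integrable (fun p : S × V => h (p.2, p.1)) ((P.map Z).prod (P.map f)) :=
    Integrable.of_bound hms.aestronglyMeasurable C (ae_of_all _ fun p => hC _)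
  calc ∫ ω, h (f ω, Z ω) ∂P
      = ∫ p, h (p.2, p.1) ∂(P.map fun ω => (Z ω, f ω)) :=
        (integral_map (hZ.prodMk hf).aemeasurable hms.aestronglyMeasurable).symm
    _ = ∫ z, ∫ v, h (v, z) ∂(P.map f) ∂(P.map Z) := by rw [hprod, integral_prod _ hint]
    _ = ∫ ω, ∫ v, h (v, Z ω) ∂(P.map f) ∂P :=
        integral_map hZ.aemeasurable
          (hms.stronglyMeasurable.integral_prod_right' (ν := P.map f)).aestronglyMeasurable
    _ = ∫ ω, ∫ ω', h (f ω', Z ω) ∂P ∂P := by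
        congr 1 with ω
        exact integral_map hf.aemeasurable
          (hm.comp measurable_prodMk_right).aestronglyMeasurable

/-- Replacing the probability parameter of a function by a variable independent of `Z`. -/
theorem integral_comp_of_indep {m₁ m₂ mΩ : MeasurableSpace Ω} [mS : MeasurableSpace S]
    {P : Measure Ω} [IsProbabilityMeasure P] {θ : Ω → Ω} (hθ : MeasurePreserving θ P P)
    (h₁ : m₁ ≤ mΩ) (h₂ : m₂ ≤ mΩ) (hind : Indep m₁ (m₂.comap θ) P) {Z : Ω → S}
    (hZ : Measurable[m₁] Z) {h : Ω × S → ℝ} (hm : Measurable[m₂.prod mS] h)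
    {C : ℝ} (hC : ∀ p, |h p| ≤ C) :
    ∫ ω, h (θ ω, Z ω) ∂P = ∫ ω, ∫ ω', h (ω', Z ω) ∂P ∂P := by
  have hθ₂ : @Measurable Ω Ω mΩ m₂ θ := hθ.measurable.mono le_rfl h₂
  -- `θ` is treated as a random variable with values in `(Ω, m₂)`; the σ-algebra it generates is
  -- then `m₂.comap θ`.
  have hind' : @IndepFun Ω S Ω mΩ mS m₂ Z θ P :=
    (@IndepFun_iff_Indep Ω S Ω mΩ mS m₂ Z θ P).2 <| indep_of_indep_of_le_left hind hZ.comap_le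
  rw [@integral_comp_indepFun Ω Ω S mΩ m₂ mS P _ θ Z hθ₂ (hZ.mono h₁ le_rfl) hind' h ⟨hm, C, hC⟩]
  congr 1 with ω
  have hmω : Measurable[mΩ] fun ω' => h (ω', Z ω) :=
    (hm.comp (@measurable_prodMk_right Ω S m₂ mS (Z ω))).mono h₂ le_rfl
  conv_rhs => rw [← hθ.map_eq]
  exact (integral_map hθ.measurable.aemeasurable hmω.aestronglyMeasurable).symm

end Freezing

/-! ### Bounded measurable functions and suprema of linear expectations -/

section BoundedMeasurable

variable {X : Type*} [MeasurableSpace X]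

theorem Lb.integrable {φ : X → ℝ} (hφ : φ ∈ Lb X) (μ : Measure X) [IsFiniteMeasure μ] :
    Integrable φ μ :=
  Integrable.of_bound hφ.1.aestronglyMeasurable hφ.2.choose (ae_of_all _ hφ.2.choose_spec)

theorem Lb.comp {S : Type*} [MeasurableSpace S] {φ : X → ℝ} (hφ : φ ∈ Lb X) {f : S → X}
    (hf : Measurable f) : (fun s => φ (f s)) ∈ Lb S :=
  ⟨hφ.1.comp hf, hφ.2.imp fun _ hC s => hC (f s)⟩

theorem Lb.abs_integral_le {φ : X → ℝ} {C : ℝ} (hC : ∀ x, |φ x| ≤ C) (μ : Measure X)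
    [IsProbabilityMeasure μ] : |∫ x, φ x ∂μ| ≤ C := by
  simpa using norm_integral_le_of_norm_le_const (μ := μ) (f := φ) (C := C)
    (ae_of_all _ fun x => hC x)

theorem Lb.add {φ ψ : X → ℝ} (hφ : φ ∈ Lb X) (hψ : ψ ∈ Lb X) : (fun x => φ x + ψ x) ∈ Lb X := by
  obtain ⟨hm, C, hC⟩ := hφ
  obtain ⟨hn, D, hD⟩ := hψ
  exact ⟨hm.add hn, C + D, fun x => (abs_add_le _ _).trans (add_le_add (hC x) (hD x))⟩

theorem Lb.const_mul {φ : X → ℝ} (hφ : φ ∈ Lb X) (c : ℝ) : (fun x => c * φ x) ∈ Lb X := by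
  obtain ⟨hm, C, hC⟩ := hφ
  refine ⟨hm.const_mul c, |c| * C, fun x => ?_⟩
  rw [abs_mul]
  exact mul_le_mul_of_nonneg_left (hC x) (abs_nonneg c)

theorem Lb.const (c : ℝ) : (fun _ => c) ∈ Lb X :=
  ⟨measurable_const, |c|, fun _ => le_rfl⟩

/-- Integration in a probability measure is a (sub)linear expectation. -/
theorem isSublinearExpectation_integral (μ : Measure X) [IsProbabilityMeasure μ] :
    IsSublinearExpectation fun φ : X → ℝ => ∫ x, φ x ∂μ where
  mono φ hφ ψ hψ h := integral_mono (Lb.integrable hφ μ) (Lb.integrable hψ μ) h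
  const c := by simp
  add_le φ hφ ψ hψ := (integral_add (Lb.integrable hφ μ) (Lb.integrable hψ μ)).le
  pos_smul φ _ c _ := integral_const_mul c φ

/-- A pointwise supremum of expectations is a sublinear expectation. -/
theorem isSublinearExpectation_of_isLUB {ι : Type*} [Nonempty ι] (μ : ι → Measure X)
    [∀ i, IsProbabilityMeasure (μ i)] {E : (X → ℝ) → ℝ}
    (hE : ∀ φ ∈ Lb X, IsLUB (Set.range fun i => ∫ x, φ x ∂(μ i)) (E φ)) :
    IsSublinearExpectation E where
  mono φ hφ ψ hψ h := by
    refine (hE φ hφ).2 ?_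
    rintro _ ⟨i, rfl⟩
    exact ((isSublinearExpectation_integral (μ i)).mono φ hφ ψ hψ h).trans ((hE ψ hψ).1 ⟨i, rfl⟩)
  const c := by
    refine (hE _ (Lb.const c)).unique ?_
    simp
  add_le φ hφ ψ hψ := by
    refine (hE _ (Lb.add hφ hψ)).2 ?_
    rintro _ ⟨i, rfl⟩
    exact ((isSublinearExpectation_integral (μ i)).add_le φ hφ ψ hψ).trans
      (add_le_add ((hE φ hφ).1 ⟨i, rfl⟩) ((hE ψ hψ).1 ⟨i, rfl⟩))
  pos_smul φ hφ c hc := by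
    refine (hE _ (Lb.const_mul hφ c)).unique ?_
    simp_rw [integral_const_mul]
    have := (hE φ hφ).mul_left hc
    rwa [← Set.range_comp] at this

end BoundedMeasurable

/-! ### The Markov property and the semigroup -/

section Semigroup

theorem le_past {Ω : Type*} {𝓕 : ℝ → ℝ → MeasurableSpace Ω} {r s : ℝ} (hrs : r ≤ s) :
    𝓕 r s ≤ past 𝓕 s :=
  le_iSup (fun r : Set.Iic s => 𝓕 (r : ℝ) s) ⟨r, hrs⟩

variable {Ω X : Type*} [mΩ : MeasurableSpace Ω] [mX : MeasurableSpace X] {P : Measure Ω}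
  {θ : ℝ → Ω → Ω} {Φ : ℝ≥0 → Ω → X → X} {𝓕 : ℝ → ℝ → MeasurableSpace Ω}

theorem IsMetricDS.measurePreserving (hθ : IsMetricDS P θ) (s : ℝ) :
    MeasurePreserving (θ s) P P :=
  ⟨hθ.measurable.comp measurable_prodMk_left, hθ.preserves s⟩

/-- The σ-algebra on `Ω` is left free so that it can be specialised to `𝓕 0 t`. -/
theorem measurable_comp_prod {S : Type*} [MeasurableSpace S] {g : Ω × X → X} (hg : Measurable g)
    {f : S → X} (hf : Measurable f) {ψ : S × X → ℝ} (hψ : Measurable ψ) :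
    Measurable fun p : Ω × S => ψ (p.2, g (p.1, f p.2)) :=
  hψ.comp (measurable_snd.prodMk (hg.comp (measurable_fst.prodMk (hf.comp measurable_snd))))

theorem IsMarkovianCocycle.past_le (hM : IsMarkovianCocycle P θ Φ 𝓕) (s : ℝ) : past 𝓕 s ≤ mΩ :=
  iSup_le fun r => hM.le _ _ r.2

theorem IsMarkovianCocycle.past_mono (hM : IsMarkovianCocycle P θ Φ 𝓕) {s t : ℝ} (hst : s ≤ t) :
    past 𝓕 s ≤ past 𝓕 t :=
  iSup_le fun r => (hM.mono r r s t le_rfl r.2 hst).trans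
    (le_iSup (fun r : Set.Iic t => 𝓕 (r : ℝ) t) ⟨r, le_trans r.2 hst⟩)

theorem IsRDS.measurable_apply (hΦ : IsRDS P θ Φ) (t : ℝ≥0) :
    Measurable fun p : Ω × X => Φ t p.1 p.2 :=
  hΦ.measurable.comp measurable_prodMk_left

theorem IsRDS.measurable_fiber (hΦ : IsRDS P θ Φ) (t : ℝ≥0) (x : X) :
    Measurable fun ω => Φ t ω x :=
  (hΦ.measurable_apply t).comp measurable_prodMk_right

theorem IsRDS.markovSemigroup_apply (hΦ : IsRDS P θ Φ) (t : ℝ≥0) {φ : X → ℝ} (hφ : Measurable φ)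
    (x : X) : markovSemigroup P Φ t φ x = ∫ ω, φ (Φ t ω x) ∂P :=
  integral_map (hΦ.measurable_fiber t x).aemeasurable hφ.aestronglyMeasurable

variable [IsProbabilityMeasure P]

/-- The Markov property: the cocycle started at time `s` is independent of the past of `s`. -/
theorem IsMarkovianCocycle.integral_comp {S : Type*} [mS : MeasurableSpace S]
    (hM : IsMarkovianCocycle P θ Φ 𝓕) (hθ : IsMetricDS P θ) (s : ℝ) (t : ℝ≥0)
    {Z : Ω → S} (hZ : Measurable[past 𝓕 s] Z) {f : S → X} (hf : Measurable f)
    {ψ : S × X → ℝ} (hψ : ψ ∈ Lb (S × X)) :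
    ∫ ω, ψ (Z ω, Φ t (θ s ω) (f (Z ω))) ∂P
      = ∫ ω, ∫ ω', ψ (Z ω, Φ t ω' (f (Z ω))) ∂P ∂P := by
  obtain ⟨hm, C, hC⟩ := hψ
  refine integral_comp_of_indep (m₂ := 𝓕 0 t) (hθ.measurePreserving s) (hM.past_le s) (hM.le 0 t t.2)
    ?_ hZ
    (h := fun p : Ω × S => ψ (p.2, Φ t p.1 (f p.2))) ?_ fun p => hC _
  -- The increment after time `s` is measurable for `θ_s⁻¹ 𝓕_0^t = 𝓕_s^{t+s}`, which is independent
  -- of the past of `s`.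
  · rw [hM.shift 0 t s t.2, zero_add]
    exact hM.indep s (t + s) (le_add_of_nonneg_left t.2)
  · exact @measurable_comp_prod Ω X (𝓕 0 t) mX S mS _ (hM.measurable t) f hf ψ hm

theorem IsRDS.integral_mem_Lb {S : Type*} [MeasurableSpace S] (hΦ : IsRDS P θ Φ) (t : ℝ≥0)
    {f : S → X} (hf : Measurable f) {ψ : S × X → ℝ} (hψ : ψ ∈ Lb (S × X)) :
    (fun z => ∫ ω, ψ (z, Φ t ω (f z)) ∂P) ∈ Lb S := by
  obtain ⟨hm, C, hC⟩ := hψ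
  refine ⟨?_, C, fun z => Lb.abs_integral_le (fun ω => hC _) P⟩
  have : Measurable fun p : S × Ω => ψ (p.1, Φ t p.2 (f p.1)) :=
    hm.comp (measurable_fst.prodMk ((hΦ.measurable_apply t).comp
      (measurable_snd.prodMk (hf.comp measurable_fst))))
  exact (this.stronglyMeasurable.integral_prod_right' (ν := P)).measurable

theorem IsRDS.markovSemigroup_mem_Lb (hΦ : IsRDS P θ Φ) (t : ℝ≥0) {φ : X → ℝ} (hφ : φ ∈ Lb X) :
    markovSemigroup P Φ t φ ∈ Lb X := by
  rw [funext (hΦ.markovSemigroup_apply t hφ.1)]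
  exact hΦ.integral_mem_Lb t measurable_id (Lb.comp hφ measurable_snd)

theorem isSublinearMarkovSemigroup_markovSemigroup (hθ : IsMetricDS P θ) (hΦ : IsRDS P θ Φ)
    (hM : IsMarkovianCocycle P θ Φ 𝓕) : IsSublinearMarkovSemigroup (markovSemigroup P Φ) where
  mapsTo t φ hφ := hΦ.markovSemigroup_mem_Lb t hφ
  sublinear t x := by
    have := Measure.isProbabilityMeasure_map (μ := P) (hΦ.measurable_fiber t x).aemeasurable
    exact isSublinearExpectation_integral _
  zero φ hφ := by
    ext x
    rw [hΦ.markovSemigroup_apply 0 hφ.1]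
    have : (fun ω => φ (Φ 0 ω x)) =ᵐ[P] fun _ => φ x := by
      filter_upwards [hΦ.cocycle] with ω hω
      simp [hω.1]
    simp [integral_congr_ae this]
  comp t s φ hφ := by
    ext x
    rw [hΦ.markovSemigroup_apply t (hΦ.markovSemigroup_mem_Lb s hφ).1,
      hΦ.markovSemigroup_apply (t + s) hφ.1]
    -- Chapman–Kolmogorov: the flow is split at time `t`, and its position there depends only on the
    -- past of `t`.
    have hcoc : (fun ω => φ (Φ (t + s) ω x)) =ᵐ[P] fun ω => φ (Φ s (θ t ω) (Φ t ω x)) := by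
      filter_upwards [hΦ.cocycle] with ω hω
      rw [add_comm, hω.2 s t, Function.comp]
    have hZ : Measurable[past 𝓕 (t : ℝ)] fun ω => Φ t ω x := by
      refine Measurable.mono ?_ (le_past t.2) le_rfl
      exact (hM.measurable t).comp (@measurable_prodMk_right Ω X (𝓕 0 t) _ x)
    rw [integral_congr_ae hcoc]
    refine Eq.trans ?_
      (hM.integral_comp hθ t s hZ measurable_id (Lb.comp hφ measurable_snd)).symm
    simp_rw [hΦ.markovSemigroup_apply s hφ.1]
    rfl

end Semigroup

/-! ### The periodic measures, invariance and finite-dimensional laws -/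

section PeriodicMeasure

variable {Ω X : Type*} [mΩ : MeasurableSpace Ω] [mX : MeasurableSpace X] {P : Measure Ω}
  {θ : ℝ → Ω → Ω} {Φ : ℝ≥0 → Ω → X → X} {𝓕 : ℝ → ℝ → MeasurableSpace Ω}
  {τ : ℝ} {Y : ℝ → Ω → X}

theorem IsRandomPeriodicPath.periodic_periodicMeasure (hY : IsRandomPeriodicPath P θ Φ τ Y)
    (hθ : IsMetricDS P θ) : Function.Periodic (periodicMeasure P Y) τ := fun s => by
  have h : Y (s + τ) =ᵐ[P] Y s ∘ θ τ := by
    filter_upwards [hY.path] with ω hω using hω.2 s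
  rw [periodicMeasure, Measure.map_congr h,
    ← Measure.map_map (hY.measurable s) (hθ.measurePreserving τ).measurable, hθ.preserves]
  rfl

variable [IsProbabilityMeasure P]

theorem IsRandomPeriodicPath.isProbabilityMeasure (hY : IsRandomPeriodicPath P θ Φ τ Y) (s : ℝ) :
    IsProbabilityMeasure (periodicMeasure P Y s) :=
  Measure.isProbabilityMeasure_map (hY.measurable s).aemeasurable

/-- By periodicity the upper expectation is the supremum over all times. -/
theorem IsRandomPeriodicPath.isLUB_upperExpectation (hY : IsRandomPeriodicPath P θ Φ τ Y)
    (hθ : IsMetricDS P θ) {φ : X → ℝ} (hφ : φ ∈ Lb X) :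
    IsLUB (Set.range fun s : ℝ => ∫ x, φ x ∂(periodicMeasure P Y s))
      (upperExpectation (periodicMeasure P Y) τ φ) := by
  have hr : (Set.range fun s : ℝ => ∫ x, φ x ∂(periodicMeasure P Y s))
      = Set.range fun s : Set.Ico (0 : ℝ) τ => ∫ x, φ x ∂(periodicMeasure P Y s) := by
    apply Set.Subset.antisymm
    · rintro _ ⟨s, rfl⟩
      obtain ⟨r, hr, h⟩ := (hY.periodic_periodicMeasure hθ).exists_mem_Ico₀ hY.period_pos s
      exact ⟨⟨r, hr⟩, by simp only [h]⟩
    · rintro _ ⟨s, rfl⟩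
      exact ⟨s, rfl⟩
  rw [hr]
  have : Nonempty (Set.Ico (0 : ℝ) τ) := ⟨⟨0, le_rfl, hY.period_pos⟩⟩
  refine isLUB_ciSup ?_
  obtain ⟨C, hC⟩ := hφ.2
  refine ⟨C, ?_⟩
  rintro _ ⟨s, rfl⟩
  have := hY.isProbabilityMeasure s
  exact (abs_le.1 (Lb.abs_integral_le hC _)).2

/-- The periodic measures form an entrance law of the semigroup. -/
theorem IsRandomPeriodicPath.integral_markovSemigroup (hY : IsRandomPeriodicPath P θ Φ τ Y)
    (hYad : IsAdaptedPath 𝓕 Y) (hθ : IsMetricDS P θ) (hΦ : IsRDS P θ Φ)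
    (hM : IsMarkovianCocycle P θ Φ 𝓕) (s : ℝ) (t : ℝ≥0) {φ : X → ℝ} (hφ : φ ∈ Lb X) :
    ∫ x, markovSemigroup P Φ t φ x ∂(periodicMeasure P Y s)
      = ∫ x, φ x ∂(periodicMeasure P Y (t + s)) := by
  have h : (fun ω => φ (Y (t + s) ω)) =ᵐ[P] fun ω => φ (Φ t (θ s ω) (Y s ω)) := by
    filter_upwards [hY.path] with ω hω
    rw [hω.1 t s]
  rw [periodicMeasure, periodicMeasure,
    integral_map (hY.measurable _).aemeasurable hφ.1.aestronglyMeasurable,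
    integral_map (hY.measurable _).aemeasurable
      (hΦ.markovSemigroup_mem_Lb t hφ).1.aestronglyMeasurable, integral_congr_ae h]
  refine Eq.trans ?_
    (hM.integral_comp hθ s t (hYad s) measurable_id (Lb.comp hφ measurable_snd)).symm
  simp_rw [hΦ.markovSemigroup_apply t hφ.1]
  rfl

theorem IsRandomPeriodicPath.isInvariantExpectation (hY : IsRandomPeriodicPath P θ Φ τ Y)
    (hYad : IsAdaptedPath 𝓕 Y) (hθ : IsMetricDS P θ) (hΦ : IsRDS P θ Φ)
    (hM : IsMarkovianCocycle P θ Φ 𝓕) :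
    IsInvariantExpectation (markovSemigroup P Φ)
      (upperExpectation (periodicMeasure P Y) τ) := fun t φ hφ => by
  refine (hY.isLUB_upperExpectation hθ (hΦ.markovSemigroup_mem_Lb t hφ)).unique ?_
  simp_rw [hY.integral_markovSemigroup hYad hθ hΦ hM _ t hφ]
  have := hY.isLUB_upperExpectation hθ hφ
  -- `P_t` replaces `ρ_s` by `ρ_{t+s}`, which merely reindexes the supremum over the whole line.
  rwa [← (Equiv.addLeft (t : ℝ)).surjective.range_comp] at this

theorem measurable_snoc (n : ℕ) :
    Measurable fun p : (Fin (n + 1) → X) × X =>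
      (Fin.snoc (α := fun _ => X) p.1 p.2 : Fin (n + 2) → X) := by
  refine measurable_pi_lambda _ fun i => ?_
  induction i using Fin.lastCases with
  | last => simpa using measurable_snd
  | cast i => simpa [Function.comp_def] using (measurable_pi_apply i).comp measurable_fst

theorem IsRDS.markovSemigroup_snoc_mem_Lb (hΦ : IsRDS P θ Φ) (δ : ℝ≥0) {n : ℕ}
    {φ : (Fin (n + 2) → X) → ℝ} (hφ : φ ∈ Lb (Fin (n + 2) → X)) :
    (fun x : Fin (n + 1) → X => markovSemigroup P Φ δ
      (fun y => φ (Fin.snoc (α := fun _ => X) x y)) (x (Fin.last n))) ∈ Lb (Fin (n + 1) → X) := by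
  have hψ := Lb.comp hφ (measurable_snoc (X := X) n)
  have h : ∀ x : Fin (n + 1) → X, Measurable fun y => φ (Fin.snoc (α := fun _ => X) x y) :=
    fun x => hψ.1.comp measurable_prodMk_left
  simp_rw [hΦ.markovSemigroup_apply δ (h _)]
  exact hΦ.integral_mem_Lb δ (measurable_pi_apply (Fin.last n)) hψ

theorem IsRDS.iterateSemigroup_mem_Lb (hΦ : IsRDS P θ Φ) :
    ∀ (n : ℕ) (t : Fin (n + 1) → ℝ) {φ : (Fin (n + 1) → X) → ℝ}, φ ∈ Lb (Fin (n + 1) → X) →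
      iterateSemigroup (markovSemigroup P Φ) n t φ ∈ Lb X
  | 0, _, _, hφ => Lb.comp hφ (measurable_pi_lambda _ fun _ => measurable_id)
  | n + 1, t, _, hφ => hΦ.iterateSemigroup_mem_Lb n (fun i => t i.castSucc)
      (hΦ.markovSemigroup_snoc_mem_Lb _ hφ)

/-- The finite-dimensional distributions of the random periodic path. -/
theorem IsRandomPeriodicPath.integral_iterateSemigroup (hY : IsRandomPeriodicPath P θ Φ τ Y)
    (hYad : IsAdaptedPath 𝓕 Y) (hθ : IsMetricDS P θ) (hΦ : IsRDS P θ Φ)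
    (hM : IsMarkovianCocycle P θ Φ 𝓕) (n : ℕ) : ∀ (t : Fin (n + 1) → ℝ), Monotone t →
    ∀ φ ∈ Lb (Fin (n + 1) → X),
    ∫ x, iterateSemigroup (markovSemigroup P Φ) n t φ x ∂(periodicMeasure P Y (t 0))
      = ∫ ω, φ (fun i => Y (t i) ω) ∂P := by
  induction n with
  | zero =>
    intro t _ φ hφ
    rw [periodicMeasure, integral_map (hY.measurable _).aemeasurable
      (hΦ.iterateSemigroup_mem_Lb 0 t hφ).1.aestronglyMeasurable]
    congr 1 with ω
    refine congrArg φ (funext fun i => ?_)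
    rw [Fin.fin_one_eq_zero i]
  | succ n ih =>
    intro t ht φ hφ
    -- `s` is the last but one time: the path up to `s` is frozen and only the step of length `δ` to
    -- the last time is integrated out.
    set s := t (Fin.last n).castSucc with hs
    set δ : ℝ≥0 := (t (Fin.last (n + 1)) - s).toNNReal with hδ
    have hδs : (δ : ℝ) + s = t (Fin.last (n + 1)) := by
      rw [hδ, Real.coe_toNNReal _ (sub_nonneg.2 (ht (Fin.le_last _))), sub_add_cancel]
    have hψ := Lb.comp hφ (measurable_snoc (X := X) n)
    have hsnoc : ∀ x : Fin (n + 1) → X, Measurable fun y => φ (Fin.snoc (α := fun _ => X) x y) :=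
      fun x => hψ.1.comp measurable_prodMk_left
    have hZ : Measurable[past 𝓕 s] fun ω (i : Fin (n + 1)) => Y (t i.castSucc) ω :=
      @measurable_pi_lambda _ _ _ (past 𝓕 s) _ _ fun i =>
        (hYad _).mono (hM.past_mono (ht (Fin.castSucc_le_castSucc_iff.2 (Fin.le_last i)))) le_rfl
    have hpath : (fun ω => φ fun i => Y (t i) ω) =ᵐ[P] fun ω =>
        φ (Fin.snoc (α := fun _ => X) (fun i : Fin (n + 1) => Y (t i.castSucc) ω)
          (Φ δ (θ s ω) (Y s ω))) := by
      filter_upwards [hY.path] with ω hω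
      rw [hω.1 δ s, hδs]
      refine congrArg φ (funext fun i => ?_)
      induction i using Fin.lastCases with
      | last => simp
      | cast i => simp
    have := ih (fun i => t i.castSucc) (fun i j hij => ht (Fin.castSucc_le_castSucc_iff.2 hij)) _
      (hΦ.markovSemigroup_snoc_mem_Lb δ hφ)
    rw [integral_congr_ae hpath]
    refine (this.trans ?_).trans (hM.integral_comp hθ s δ hZ (measurable_pi_apply (Fin.last n))
      (Lb.comp hφ (measurable_snoc n))).symm
    simp_rw [hΦ.markovSemigroup_apply δ (hsnoc _)]

end PeriodicMeasure

/-! ### Shifts, completions and null events on the path space -/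

section PathSpace

variable {X : Type*}

theorem pathShift_comp (s t : ℝ) : pathShift (X := X) s ∘ pathShift t = pathShift (s + t) := by
  ext ω r
  simp only [Function.comp, pathShift]
  congr 1
  ring

theorem pathShift_zero : pathShift (X := X) 0 = id := by
  ext ω r
  simp [pathShift]

/-- The iterated semigroup depends only on the differences of the times. -/
theorem iterateSemigroup_add (T : ℝ≥0 → (X → ℝ) → X → ℝ) (r : ℝ) :
    ∀ (n : ℕ) (t : Fin (n + 1) → ℝ) (φ : (Fin (n + 1) → X) → ℝ),
      iterateSemigroup T n (fun i => r + t i) φ = iterateSemigroup T n t φ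
  | 0, _, _ => rfl
  | n + 1, t, φ => by
    simp only [iterateSemigroup, add_sub_add_left_eq_sub]
    exact iterateSemigroup_add T r n (fun i => t i.castSucc) _

variable [MeasurableSpace X]

theorem measurable_pathShift (t : ℝ) : Measurable (pathShift (X := X) t) :=
  measurable_pi_lambda _ fun s => measurable_pi_apply (t + s)

/-- `cylinderExpectation` sees only differences of times, so testing the image of `Q` at times `t i`
is testing `Q` at `r + t i` against the same bound. -/
theorem map_pathShift_mem_pathMeasures (T : ℝ≥0 → (X → ℝ) → X → ℝ) (E : (X → ℝ) → ℝ) (r : ℝ)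
    {Q : Measure (ℝ → X)} (hQ : Q ∈ pathMeasures T E) : Q.map (pathShift r) ∈ pathMeasures T E := by
  obtain ⟨hp, hQ⟩ := hQ
  refine ⟨Measure.isProbabilityMeasure_map (measurable_pathShift r).aemeasurable,
    fun n t φ ht hφ => ?_⟩
  have hm : Measurable fun ω : ℝ → X => φ fun i => ω (t i) :=
    hφ.1.comp (measurable_pi_lambda _ fun i => measurable_pi_apply (t i))
  rw [integral_map (measurable_pathShift r).aemeasurable hm.aestronglyMeasurable]
  have := hQ n (fun i => r + t i) φ (fun i j hij => by simpa using ht hij) hφ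
  rwa [cylinderExpectation, iterateSemigroup_add] at this

/-- The shifts act on the set of path measures. -/
noncomputable def pathMeasuresShift (T : ℝ≥0 → (X → ℝ) → X → ℝ) (E : (X → ℝ) → ℝ) (r : ℝ) :
    pathMeasures T E ≃ pathMeasures T E where
  toFun Q := ⟨_, map_pathShift_mem_pathMeasures T E r Q.2⟩
  invFun Q := ⟨_, map_pathShift_mem_pathMeasures T E (-r) Q.2⟩
  left_inv Q := by
    ext1
    simp [Measure.map_map (measurable_pathShift _) (measurable_pathShift _), pathShift_comp,
      pathShift_zero]
  right_inv Q := by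
    ext1
    simp [Measure.map_map (measurable_pathShift _) (measurable_pathShift _), pathShift_comp,
      pathShift_zero]

/-- Composing with a shift permutes the measures over which the supremum runs. -/
theorem pathNorm_comp_pathShift (T : ℝ≥0 → (X → ℝ) → X → ℝ) (E : (X → ℝ) → ℝ) (r : ℝ)
    {ξ : (ℝ → X) → ℝ} (hξ : Measurable ξ) : pathNorm T E (ξ ∘ pathShift r) = pathNorm T E ξ := by
  rw [pathNorm, pathNorm, ← (pathMeasuresShift T E r).iSup_comp
    (g := fun Q : pathMeasures T E => eLpNorm ξ 2 (Q : Measure (ℝ → X)))]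
  congr 1 with Q
  exact (eLpNorm_map_measure hξ.aestronglyMeasurable
    (measurable_pathShift r).aemeasurable).symm

theorem pathExpectation_comp_pathShift (T : ℝ≥0 → (X → ℝ) → X → ℝ) (E : (X → ℝ) → ℝ) (r : ℝ)
    {ξ : (ℝ → X) → ℝ} (hξ : Measurable ξ) :
    pathExpectation T E (ξ ∘ pathShift r) = pathExpectation T E ξ := by
  rw [pathExpectation, pathExpectation, ← (pathMeasuresShift T E r).iSup_comp
    (g := fun Q : pathMeasures T E => ∫ ω, ξ ω ∂(Q : Measure (ℝ → X)))]
  congr 1 with Q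
  exact (integral_map (measurable_pathShift r).aemeasurable hξ.aestronglyMeasurable).symm

/-- A completion is stable under the shifts when the underlying space of functions is. -/
theorem comp_pathShift_mem_pathCompletion {T : ℝ≥0 → (X → ℝ) → X → ℝ} {E : (X → ℝ) → ℝ}
    {C : Set ((ℝ → X) → ℝ)} (hCm : ∀ η ∈ C, Measurable η) {r : ℝ}
    (hC : ∀ η ∈ C, η ∘ pathShift r ∈ C) {ξ : (ℝ → X) → ℝ} (hξ : ξ ∈ pathCompletion T E C) :
    ξ ∘ pathShift r ∈ pathCompletion T E C := by
  refine ⟨hξ.1.comp (measurable_pathShift r), fun ε hε => ?_⟩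
  obtain ⟨η, hη, h⟩ := hξ.2 ε hε
  refine ⟨η ∘ pathShift r, hC η hη, ?_⟩
  have := pathNorm_comp_pathShift T E r (hξ.1.sub (hCm η hη))
  rw [← this] at h
  exact h

theorem measurable_of_mem_cylinderFunctions {η : (ℝ → X) → ℝ} (hη : η ∈ cylinderFunctions X) :
    Measurable η := by
  obtain ⟨n, t, φ, -, hφ, rfl⟩ := hη
  exact hφ.1.comp (measurable_pi_lambda _ fun i => measurable_pi_apply (t i))

theorem comp_pathShift_mem_cylinderFunctions (r : ℝ) {η : (ℝ → X) → ℝ}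
    (hη : η ∈ cylinderFunctions X) : η ∘ pathShift r ∈ cylinderFunctions X := by
  obtain ⟨n, t, φ, ht, hφ, rfl⟩ := hη
  exact ⟨n, fun i => r + t i, φ, fun i j hij => by simpa using ht hij, hφ, rfl⟩

theorem comp_pathShift_mem_lipCylinderFunctions {X : Type*} [PseudoMetricSpace X] (r : ℝ)
    {η : (ℝ → X) → ℝ} (hη : η ∈ lipCylinderFunctions X) :
    η ∘ pathShift r ∈ lipCylinderFunctions X := by
  obtain ⟨n, t, φ, ht, hφ, hb, rfl⟩ := hη
  exact ⟨n, fun i => r + t i, φ, fun i j hij => by simpa using ht hij, hφ, hb, rfl⟩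

/-- Second countability makes open sets of the finite power measurable for the product σ-algebra. -/
theorem lipCylinderFunctions_subset {X : Type*} [PseudoMetricSpace X] [SecondCountableTopology X]
    [MeasurableSpace X] [BorelSpace X] : lipCylinderFunctions X ⊆ cylinderFunctions X := by
  rintro _ ⟨n, t, φ, ht, ⟨K, hK⟩, hb, rfl⟩
  exact ⟨n, t, φ, ht, ⟨hK.continuous.measurable, hb⟩, rfl⟩

theorem pathCompletion_mono (T : ℝ≥0 → (X → ℝ) → X → ℝ) (E : (X → ℝ) → ℝ)
    {C D : Set ((ℝ → X) → ℝ)} (h : C ⊆ D) : pathCompletion T E C ⊆ pathCompletion T E D :=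
  fun _ hξ => ⟨hξ.1, fun ε hε => (hξ.2 ε hε).imp fun _ hη => ⟨h hη.1, hη.2⟩⟩

/-- On a probability space the `L¹` norm is at most the `L²` norm; the point is that the bound is
uniform in `Q`. -/
theorem abs_integral_sub_le_of_pathNorm {T : ℝ≥0 → (X → ℝ) → X → ℝ} {E : (X → ℝ) → ℝ}
    {ξ η : (ℝ → X) → ℝ} (hξ : ξ ∈ Lb (ℝ → X)) (hη : η ∈ Lb (ℝ → X)) {ε : ℝ} (hε : 0 ≤ ε)
    (h : pathNorm T E (ξ - η) < ENNReal.ofReal ε) {Q : Measure (ℝ → X)}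
    (hQ : Q ∈ pathMeasures T E) : |∫ ω, ξ ω ∂Q - ∫ ω, η ω ∂Q| ≤ ε := by
  have := hQ.1
  rw [← integral_sub (Lb.integrable hξ Q) (Lb.integrable hη Q), ← Real.norm_eq_abs]
  refine (norm_integral_le_integral_norm _).trans ?_
  have hm : AEStronglyMeasurable (ξ - η) Q := (hξ.1.sub hη.1).aestronglyMeasurable
  change ∫ ω, ‖(ξ - η) ω‖ ∂Q ≤ ε
  rw [integral_norm_eq_lintegral_enorm hm, ← eLpNorm_one_eq_lintegral_enorm]
  refine ENNReal.toReal_le_of_le_ofReal hε ?_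
  calc eLpNorm (ξ - η) 1 Q ≤ eLpNorm (ξ - η) 2 Q :=
        eLpNorm_le_eLpNorm_of_exponent_le (by norm_num) hm
    _ ≤ pathNorm T E (ξ - η) :=
        le_iSup (fun Q : pathMeasures T E => eLpNorm (ξ - η) 2 (Q : Measure (ℝ → X))) ⟨Q, hQ⟩
    _ ≤ ENNReal.ofReal ε := h.le

/-- A set of path measures which attains `E` on the cylinder functions attains it on bounded
elements of their completion. -/
theorem integral_le_of_mem_pathCompletion {T : ℝ≥0 → (X → ℝ) → X → ℝ} {E : (X → ℝ) → ℝ}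
    {ι : Type*} {R : ι → Measure (ℝ → X)} (hR : ∀ i, R i ∈ pathMeasures T E)
    (hLUB : ∀ η ∈ cylinderFunctions X, ∀ c : ℝ, (∀ i, ∫ ω, η ω ∂(R i) ≤ c) →
      ∀ Q ∈ pathMeasures T E, ∫ ω, η ω ∂Q ≤ c)
    {ξ : (ℝ → X) → ℝ} (hξ : ξ ∈ pathCompletion T E (cylinderFunctions X)) (hb : ξ ∈ Lb (ℝ → X))
    {c : ℝ} (hc : ∀ i, ∫ ω, ξ ω ∂(R i) ≤ c) {Q : Measure (ℝ → X)} (hQ : Q ∈ pathMeasures T E) :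
    ∫ ω, ξ ω ∂Q ≤ c := by
  refine le_of_forall_pos_le_add fun ε hε => ?_
  obtain ⟨η, hη, h⟩ := hξ.2 (ENNReal.ofReal (ε / 2)) (by simpa using hε)
  have hηb : η ∈ Lb (ℝ → X) := by
    obtain ⟨n, t, φ, -, hφ, rfl⟩ := hη
    exact Lb.comp hφ (measurable_pi_lambda _ fun i => measurable_pi_apply (t i))
  -- The same `η` serves all measures: one `ε / 2` is lost passing from `ξ` to `η` under `R i`, the
  -- other returning to `ξ` under `Q`.
  have key := fun {Q} (hQ : Q ∈ pathMeasures T E) =>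
    abs_le.1 (abs_integral_sub_le_of_pathNorm hb hηb (half_pos hε).le h hQ)
  have h1 := hLUB η hη (c + ε / 2) (fun i => by linarith [hc i, (key (hR i)).1]) Q hQ
  linarith [(key hQ).2]

theorem neg_mem_cylinderFunctions {η : (ℝ → X) → ℝ} (hη : η ∈ cylinderFunctions X) :
    -η ∈ cylinderFunctions X := by
  obtain ⟨n, t, φ, ht, ⟨hm, C, hC⟩, rfl⟩ := hη
  exact ⟨n, t, -φ, ht, ⟨hm.neg, C, fun x => by simpa using hC x⟩, rfl⟩

theorem neg_mem_pathCompletion {T : ℝ≥0 → (X → ℝ) → X → ℝ} {E : (X → ℝ) → ℝ}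
    {ξ : (ℝ → X) → ℝ} (hξ : ξ ∈ pathCompletion T E (cylinderFunctions X)) :
    -ξ ∈ pathCompletion T E (cylinderFunctions X) := by
  refine ⟨hξ.1.neg, fun ε hε => ?_⟩
  obtain ⟨η, hη, h⟩ := hξ.2 ε hε
  refine ⟨-η, neg_mem_cylinderFunctions hη, ?_⟩
  have : -ξ - -η = -(ξ - η) := by ring
  simpa only [this, pathNorm, eLpNorm_neg] using h

theorem indicator_one_mem_Lb {S : Type*} [MeasurableSpace S] {B : Set S} (hB : MeasurableSet B) :
    B.indicator (1 : S → ℝ) ∈ Lb S :=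
  ⟨measurable_one.indicator hB, 1, fun x => by by_cases h : x ∈ B <;> simp [h]⟩

/-- The bound 1 on probabilities is what lets the real-valued supremum dominate each of its terms.
-/
theorem measure_eq_zero_of_pathExpectation {T : ℝ≥0 → (X → ℝ) → X → ℝ} {E : (X → ℝ) → ℝ}
    {B : Set (ℝ → X)} (hB : MeasurableSet B) (h : pathExpectation T E (B.indicator 1) = 0)
    {Q : Measure (ℝ → X)} (hQ : Q ∈ pathMeasures T E) : Q B = 0 := by
  have hp := hQ.1
  have hbdd : BddAbove (Set.range fun Q : pathMeasures T E =>
      ∫ ω, B.indicator (1 : (ℝ → X) → ℝ) ω ∂(Q : Measure (ℝ → X))) := by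
    refine ⟨1, ?_⟩
    rintro _ ⟨Q, rfl⟩
    have := Q.2.1
    simp only [integral_indicator_one hB]
    exact measureReal_le_one
  have h1 := le_ciSup hbdd ⟨Q, hQ⟩
  rw [pathExpectation] at h
  rw [h] at h1
  simp only [integral_indicator_one hB] at h1
  exact (measureReal_eq_zero_iff).1 (le_antisymm h1 measureReal_nonneg)

theorem pathExpectation_eq_zero {T : ℝ≥0 → (X → ℝ) → X → ℝ} {E : (X → ℝ) → ℝ}
    {B : Set (ℝ → X)} (hB : MeasurableSet B) (h : ∀ Q ∈ pathMeasures T E, Q B = 0) :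
    pathExpectation T E (B.indicator 1) = 0 := by
  have : ∀ Q : pathMeasures T E,
      ∫ ω, B.indicator (1 : (ℝ → X) → ℝ) ω ∂(Q : Measure (ℝ → X)) = 0 := fun Q => by
    rw [integral_indicator_one hB, measureReal_def, h Q Q.2, ENNReal.toReal_zero]
  simp [pathExpectation, this]

end PathSpace

/-! ### Laws of the random periodic path and ergodicity -/

section Canonical

variable {Ω X : Type*} [mΩ : MeasurableSpace Ω] [mX : MeasurableSpace X] {P : Measure Ω}
  {θ : ℝ → Ω → Ω} {Φ : ℝ≥0 → Ω → X → X} {𝓕 : ℝ → ℝ → MeasurableSpace Ω}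
  {τ : ℝ} {Y : ℝ → Ω → X}

/-- The law of the path `r ↦ Y(s + r, ·)`. -/
noncomputable def pathLaw (P : Measure Ω) (Y : ℝ → Ω → X) (s : ℝ) : Measure (ℝ → X) :=
  P.map fun ω r => Y (s + r) ω

theorem IsRandomPeriodicPath.measurable_path (hY : IsRandomPeriodicPath P θ Φ τ Y) (s : ℝ) :
    Measurable fun ω r => Y (s + r) ω :=
  measurable_pi_lambda _ fun r => hY.measurable (s + r)

theorem IsRandomPeriodicPath.map_pathShift_pathLaw (hY : IsRandomPeriodicPath P θ Φ τ Y) (s : ℝ) :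
    (pathLaw P Y 0).map (pathShift s) = pathLaw P Y s := by
  rw [pathLaw, pathLaw, Measure.map_map (measurable_pathShift s) (hY.measurable_path 0)]
  congr 1
  ext ω r
  simp [pathShift]

/-- The law of the random periodic path is trivial on events invariant under the shift by the
period, because `θ_τ` is ergodic. -/
theorem IsRandomPeriodicPath.pathLaw_eq_zero_or (hY : IsRandomPeriodicPath P θ Φ τ Y)
    (hErg : Ergodic (θ τ) P) {B : Set (ℝ → X)} (hB : MeasurableSet B)
    (h : pathShift τ ⁻¹' B =ᵐ[pathLaw P Y 0] B) :
    pathLaw P Y 0 B = 0 ∨ pathLaw P Y 0 Bᶜ = 0 := by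
  have hm := hY.measurable_path 0
  set y : Ω → ℝ → X := fun ω r => Y (0 + r) ω with hy
  have h1 : y ⁻¹' (pathShift τ ⁻¹' B) =ᵐ[P] y ⁻¹' B :=
    (Measure.QuasiMeasurePreserving.mk hm Measure.AbsolutelyContinuous.rfl).preimage_ae_eq h
  -- The relation `Y(r + τ, ω) = Y(r, θ_τ ω)` says that `y` intertwines `θ τ` with `pathShift τ`.
  have h2 : θ τ ⁻¹' (y ⁻¹' B) =ᵐ[P] y ⁻¹' (pathShift τ ⁻¹' B) := by
    filter_upwards [hY.path] with ω hω
    have : y (θ τ ω) = pathShift τ (y ω) := by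
      ext r
      simp only [hy, pathShift, zero_add, add_comm τ r, hω.2 r]
    change (y (θ τ ω) ∈ B) = (pathShift τ (y ω) ∈ B)
    rw [this]
  have h3 := hErg.quasiErgodic.ae_empty_or_univ₀ (hm hB).nullMeasurableSet (h2.trans h1)
  rw [pathLaw, Measure.map_apply hm hB, Measure.map_apply hm hB.compl]
  exact h3.imp ae_eq_empty.1 fun h => ae_eq_univ.1 h

variable [IsProbabilityMeasure P]

/-- On cylinder functions the sublinear expectation is the supremum over the laws of the shifted
random periodic path. -/
theorem IsRandomPeriodicPath.isLUB_cylinderExpectation (hY : IsRandomPeriodicPath P θ Φ τ Y)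
    (hYad : IsAdaptedPath 𝓕 Y) (hθ : IsMetricDS P θ) (hΦ : IsRDS P θ Φ)
    (hM : IsMarkovianCocycle P θ Φ 𝓕) (n : ℕ) (t : Fin (n + 1) → ℝ)
    (φ : (Fin (n + 1) → X) → ℝ) (ht : StrictMono t) (hφ : φ ∈ Lb (Fin (n + 1) → X)) :
    IsLUB (Set.range fun s : ℝ => ∫ ω, φ (fun i => ω (t i)) ∂(pathLaw P Y s))
      (cylinderExpectation (markovSemigroup P Φ) (upperExpectation (periodicMeasure P Y) τ)
        n t φ) := by
  have h := hY.isLUB_upperExpectation hθ (hΦ.iterateSemigroup_mem_Lb n t hφ)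
  -- The iterated semigroup is integrated against the law at the first time, which is `s + t 0` for
  -- the path shifted by `s`.
  rw [← (Equiv.addRight (t 0)).surjective.range_comp] at h
  rw [cylinderExpectation]
  convert h using 3 with s
  have hm : Measurable fun ω : ℝ → X => φ fun i => ω (t i) :=
    hφ.1.comp (measurable_pi_lambda _ fun i => measurable_pi_apply (t i))
  rw [pathLaw, integral_map (hY.measurable_path s).aemeasurable hm.aestronglyMeasurable,
    ← hY.integral_iterateSemigroup hYad hθ hΦ hM n (fun i => s + t i)
      (fun i j hij => by simpa using ht.monotone hij) φ hφ, iterateSemigroup_add]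
  rfl

theorem IsRandomPeriodicPath.pathLaw_mem_pathMeasures (hY : IsRandomPeriodicPath P θ Φ τ Y)
    (hYad : IsAdaptedPath 𝓕 Y) (hθ : IsMetricDS P θ) (hΦ : IsRDS P θ Φ)
    (hM : IsMarkovianCocycle P θ Φ 𝓕) (s : ℝ) :
    pathLaw P Y s ∈ pathMeasures (markovSemigroup P Φ)
      (upperExpectation (periodicMeasure P Y) τ) :=
  ⟨Measure.isProbabilityMeasure_map (hY.measurable_path s).aemeasurable, fun n t φ ht hφ =>
    (hY.isLUB_cylinderExpectation hYad hθ hΦ hM n t φ ht hφ).1 ⟨s, rfl⟩⟩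

theorem IsRandomPeriodicPath.extendsCylinderExpectation (hY : IsRandomPeriodicPath P θ Φ τ Y)
    (hYad : IsAdaptedPath 𝓕 Y) (hθ : IsMetricDS P θ) (hΦ : IsRDS P θ Φ)
    (hM : IsMarkovianCocycle P θ Φ 𝓕) :
    ExtendsCylinderExpectation (markovSemigroup P Φ)
      (upperExpectation (periodicMeasure P Y) τ) := fun n t φ ht hφ => by
  have hmem := hY.pathLaw_mem_pathMeasures hYad hθ hΦ hM
  have : Nonempty (pathMeasures (markovSemigroup P Φ)
      (upperExpectation (periodicMeasure P Y) τ)) := ⟨⟨_, hmem 0⟩⟩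
  apply le_antisymm
  · exact ciSup_le fun Q => Q.2.2 n t φ ht hφ
  · refine (hY.isLUB_cylinderExpectation hYad hθ hΦ hM n t φ ht hφ).2 ?_
    rintro _ ⟨s, rfl⟩
    refine le_ciSup (f := fun Q : pathMeasures (markovSemigroup P Φ)
      (upperExpectation (periodicMeasure P Y) τ) => ∫ ω, φ (fun i => ω (t i))
        ∂(Q : Measure (ℝ → X))) ⟨cylinderExpectation (markovSemigroup P Φ)
      (upperExpectation (periodicMeasure P Y) τ) n t φ, ?_⟩ ⟨_, hmem s⟩
    rintro _ ⟨Q, rfl⟩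
    exact Q.2.2 n t φ ht hφ

theorem IsRandomPeriodicPath.isErgodicSystem (hY : IsRandomPeriodicPath P θ Φ τ Y)
    (hYad : IsAdaptedPath 𝓕 Y) (hθ : IsMetricDS P θ) (hΦ : IsRDS P θ Φ)
    (hM : IsMarkovianCocycle P θ Φ 𝓕) (hErg : Ergodic (θ τ) P) {C : Set ((ℝ → X) → ℝ)}
    (hC : C ⊆ cylinderFunctions X) (hCs : ∀ r : ℝ, ∀ η ∈ C, η ∘ pathShift r ∈ C) :
    IsErgodicSystem
      (pathCompletion (markovSemigroup P Φ) (upperExpectation (periodicMeasure P Y) τ) C)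
      (pathExpectation (markovSemigroup P Φ) (upperExpectation (periodicMeasure P Y) τ))
      pathShift where
  preserves r ξ hξ :=
    ⟨comp_pathShift_mem_pathCompletion (fun η hη => measurable_of_mem_cylinderFunctions (hC hη))
      (hCs r) hξ, pathExpectation_comp_pathShift _ _ r hξ.1⟩
  ergodic B hB hinv := by
    have hmem := hY.pathLaw_mem_pathMeasures hYad hθ hΦ hM
    have hBm : MeasurableSet B := (measurable_indicator_const_iff (1 : ℝ)).1 hB.1
    have hB' := pathCompletion_mono _ _ hC hB
    have hLUB : ∀ η ∈ cylinderFunctions X, ∀ c : ℝ, (∀ s, ∫ ω, η ω ∂(pathLaw P Y s) ≤ c) →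
        ∀ Q ∈ pathMeasures (markovSemigroup P Φ) (upperExpectation (periodicMeasure P Y) τ),
          ∫ ω, η ω ∂Q ≤ c := by
      rintro _ ⟨n, t, φ, ht, hφ, rfl⟩ c hc Q hQ
      refine (hQ.2 n t φ ht hφ).trans
        ((hY.isLUB_cylinderExpectation hYad hθ hΦ hM n t φ ht hφ).2 ?_)
      rintro _ ⟨s, rfl⟩
      exact hc s
    -- Quasi-sure invariance is needed only under the single measure `pathLaw P Y 0`.
    have hshift : ∀ r, pathShift r ⁻¹' B =ᵐ[pathLaw P Y 0] B := fun r =>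
      measure_symmDiff_eq_zero_iff.1 (measure_eq_zero_of_pathExpectation
        ((measurable_pathShift r hBm).symmDiff hBm) (hinv r) (hmem 0))
    have hconst : ∀ s, pathLaw P Y s B = pathLaw P Y 0 B := fun s => by
      rw [← hY.map_pathShift_pathLaw s, Measure.map_apply (measurable_pathShift s) hBm]
      exact measure_congr (hshift s)
    refine (hY.pathLaw_eq_zero_or hErg hBm (hshift τ)).imp (fun h0 => ?_) fun h0 => ?_
    · refine pathExpectation_eq_zero hBm fun Q hQ => ?_
      have := hQ.1
      have h1 := integral_le_of_mem_pathCompletion hmem hLUB hB' (indicator_one_mem_Lb hBm)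
        (c := 0) (fun s => by
          rw [integral_indicator_one hBm, measureReal_def, hconst s, h0, ENNReal.toReal_zero]) hQ
      rw [integral_indicator_one hBm] at h1
      exact (measureReal_eq_zero_iff).1 (le_antisymm h1 measureReal_nonneg)
    · refine pathExpectation_eq_zero hBm.compl fun Q hQ => ?_
      have := hQ.1
      have hp := (hmem 0).1
      have hone : pathLaw P Y 0 B = 1 := (prob_compl_eq_zero_iff hBm).1 h0
      -- By sublinearity `E[1_{Bᶜ}]` is not determined by `E[1_B]`. A lower bound `Q B ≥ 1` is
      -- required for every `Q`; it is the upper bound `-1` for the integral of `-1_B`.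
      have hneg : ∀ μ : Measure (ℝ → X),
          ∫ ω, (-(B.indicator (1 : (ℝ → X) → ℝ))) ω ∂μ = -μ.real B := fun μ => by
        simp only [Pi.neg_apply]
        rw [integral_neg, integral_indicator_one hBm]
      have hb : -(B.indicator (1 : (ℝ → X) → ℝ)) ∈ Lb (ℝ → X) := by
        have := Lb.const_mul (indicator_one_mem_Lb hBm) (-1)
        simp only [neg_one_mul] at this
        exact this
      have h1 := integral_le_of_mem_pathCompletion hmem hLUB (neg_mem_pathCompletion hB') hb
        (c := -1) (fun s => by
          rw [hneg, measureReal_def, hconst s, hone, ENNReal.toReal_one]) hQ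
      rw [hneg] at h1
      rw [← measureReal_eq_zero_iff, probReal_compl_eq_one_sub hBm]
      linarith [measureReal_le_one (μ := Q) (s := B)]

end Canonical

end UpperExpectation

theorem mainTheorem10 {Ω X : Type*} [MeasurableSpace Ω]
    [MetricSpace X] [CompleteSpace X] [SecondCountableTopology X]
    [MeasurableSpace X] [BorelSpace X]
    (P : Measure Ω) [IsProbabilityMeasure P] (θ : ℝ → Ω → Ω) (hθ : IsMetricDS P θ)
    (Φ : ℝ≥0 → Ω → X → X) (hΦ : IsRDS P θ Φ)
    (𝓕 : ℝ → ℝ → MeasurableSpace Ω) (hM : IsMarkovianCocycle P θ Φ 𝓕)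
    (τ : ℝ) (Y : ℝ → Ω → X) (hY : IsRandomPeriodicPath P θ Φ τ Y) (hYad : IsAdaptedPath 𝓕 Y)
    (hA : ConditionA P Φ τ Y) (hErg : Ergodic (θ τ) P)
    (T : ℝ≥0 → (X → ℝ) → X → ℝ) (hT : T = markovSemigroup P Φ)
    (E : (X → ℝ) → ℝ) (hE : E = upperExpectation (periodicMeasure P Y) τ) :
    IsSublinearMarkovSemigroup T ∧
    IsSublinearExpectation E ∧
    IsInvariantExpectation T E ∧
    ExtendsCylinderExpectation T E ∧
    IsErgodicSystem (pathCompletion T E (lipCylinderFunctions X)) (pathExpectation T E)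
      pathShift ∧
    IsErgodicSystem (pathCompletion T E (cylinderFunctions X)) (pathExpectation T E)
      pathShift := by
  subst hT hE
  have hprob := hY.isProbabilityMeasure
  exact ⟨isSublinearMarkovSemigroup_markovSemigroup hθ hΦ hM,
    isSublinearExpectation_of_isLUB _ fun φ hφ => hY.isLUB_upperExpectation hθ hφ,
    hY.isInvariantExpectation hYad hθ hΦ hM,
    hY.extendsCylinderExpectation hYad hθ hΦ hM,
    hY.isErgodicSystem hYad hθ hΦ hM hErg lipCylinderFunctions_subset
      fun r _ hη => comp_pathShift_mem_lipCylinderFunctions r hη,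
    hY.isErgodicSystem hYad hθ hΦ hM hErg subset_rfl
      fun r _ hη => comp_pathShift_mem_cylinderFunctions r hη⟩
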